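/- Let $\mathfrak a$ be a finite-dimensional real inner product space and let $\Phi\subset\mathfrak a^*$ be a finite reduced crystallographic root system (not necessarily spanning $\mathfrak a^*$) whose Weyl group $W$ acts on $\mathfrak a$ by isometries (for instance, the root system of a connected complex reductive Lie group). Let $\Phi_+$ be a system of positive roots. Identify $\mathfrak a^*$ with $\mathfrak a$ by the inner product, let $dy$ be Lebesgue measure, and put $$\pi(y)=\prod_{\alpha\in\Phi_+}\langle\alpha,y\rangle^2 .$$ Let $\Omega\subseteq\mathfrak a$ be open. A function $f:\Omega\to\mathbb R$ is called convex if it satisfies the convexity inequality along every segment contained in $\Omega$. Its normal mapping is $$\partial f(x)=\{p:\ f(z)\ge f(x)+\langle p,z-x\rangle\ \ \forall z\in\Omega\}\quad (x\in\Omega),\qquad \partial f(S)=\bigcup_{x\in S}\partial f(x),$$ and the weighted real Monge–Ampère measure of a convex function $f$ on $\Omega$ is the Borel measure on $\Omega$ given by $$\int_S \mathrm{MA}_{\mathbb R;\pi}(f)\,dx=\int_{\partial f(S)}\pi\,dy,\qquad S\subseteq\Omega\ \text{Borel}.$$ **Proposition (comparison principle).** Let $\Omega\subset\mathfrak a$ be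 a bounded $W$-invariant domain (a nonempty connected open set), and let $\varphi,\psi:\Omega\to\mathbb R$ be convex functions such that $\varphi\ge\psi$ on $\Omega$ and $\varphi-\psi=0$ on $\partial\Omega$, i.e. $\varphi(x)-\psi(x)\to0$ as $x\in\Omega$ tends to any point of $\partial\Omega$. Then $$\int_\Omega \mathrm{MA}_{\mathbb R;\pi}(\varphi)\,dx\ \le\ \int_\Omega \mathrm{MA}_{\mathbb R;\pi}(\psi)\,dx ,$$ where both sides are in $[0,+\infty]$. -/

import Mathlib

open MeasureTheory Set Filter Topology
open scoped RealInnerProductSpace ENNReal NNReal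

namespace WeightedMA

section RootData

variable {𝔞 : Type*} [AddCommGroup 𝔞] [Module ℝ 𝔞] {ι : Type*}

/-- The Weyl group, acting on `𝔞`: the group generated by the reflections
`x ↦ x - α(x) α^∨` attached to the roots. -/
def weylGroup (P : RootPairing ι ℝ (Module.Dual ℝ 𝔞) 𝔞) : Subgroup (𝔞 ≃ₗ[ℝ] 𝔞) :=
  Subgroup.closure (range P.coreflection)

/-- A subset of `𝔞` is `W`-invariant if every element of the Weyl group maps it onto itself. -/
def IsWeylInvariant (P : RootPairing ι ℝ (Module.Dual ℝ 𝔞) 𝔞) (S : Set 𝔞) : Prop :=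
  ∀ w ∈ weylGroup P, w '' S = S

open Classical in
/-- The weight `π(y) = ∏_{α ∈ Φ₊} ⟨α, y⟩²`, where `Φ₊` is the set of roots that are positive with
respect to the base `b`. The dual space `𝔞*` is identified with `𝔞` through the inner product of
`𝔞`, and under this identification `⟨α, y⟩` is the value `α(y)`. -/
noncomputable def weight [Fintype ι] {P : RootPairing ι ℝ (Module.Dual ℝ 𝔞) 𝔞} (b : P.Base)
    (y : 𝔞) : ℝ :=
  ∏ i ∈ Finset.univ.filter (fun i => b.IsPos i), (P.root i y) ^ 2

end RootData

section Convex

variable {E : Type*} [NormedAddCommGroup E] [InnerProductSpace ℝ E]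

/-- `f` is a convex function on the set `Ω` (not necessarily a convex set): the convexity
inequality holds along every segment contained in `Ω`. -/
def IsConvexFun (Ω : Set E) (f : E → ℝ) : Prop :=
  ∀ x y : E, segment ℝ x y ⊆ Ω → ∀ s t : ℝ, 0 ≤ s → 0 ≤ t → s + t = 1 →
    f (s • x + t • y) ≤ s * f x + t * f y

/-- On a convex set this is the usual notion of a convex function. -/
theorem isConvexFun_iff_convexOn {Ω : Set E} (hΩ : Convex ℝ Ω) {f : E → ℝ} :
    IsConvexFun Ω f ↔ ConvexOn ℝ Ω f := by
  constructor
  · intro h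
    refine ⟨hΩ, ?_⟩
    intro x hx y hy s t hs ht hst
    exact h x y (hΩ.segment_subset hx hy) s t hs ht hst
  · intro h x y hxy s t hs ht hst
    exact h.2 (hxy (left_mem_segment ℝ x y)) (hxy (right_mem_segment ℝ x y)) hs ht hst

/-- The normal mapping of `f : Ω → ℝ` at the point `x`: the slopes `p` of all affine functions
that agree with `f` at `x` and lie below `f` on `Ω`. -/
def normalMap (Ω : Set E) (f : E → ℝ) (x : E) : Set E :=
  {p | ∀ z ∈ Ω, f x + ⟪p, z - x⟫ ≤ f z}

/-- The image `∂f(S) = ⋃_{x ∈ S ∩ Ω} ∂f(x)` of a set under the normal mapping. -/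
def normalImage (Ω : Set E) (f : E → ℝ) (S : Set E) : Set E :=
  ⋃ x ∈ S ∩ Ω, normalMap Ω f x

theorem mem_normalImage {Ω : Set E} {f : E → ℝ} {S : Set E} {p : E} :
    p ∈ normalImage Ω f S ↔ ∃ x, (x ∈ S ∧ x ∈ Ω) ∧ p ∈ normalMap Ω f x := by
  simp [normalImage]

theorem IsConvexFun.continuousOn [FiniteDimensional ℝ E] {Ω : Set E} {f : E → ℝ} (hf : IsConvexFun Ω f)
    (hΩ : IsOpen Ω) : ContinuousOn f Ω := by
  intro x hx
  obtain ⟨r, hr, hb⟩ := Metric.isOpen_iff.1 hΩ x hx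
  have hc : ConvexOn ℝ (Metric.ball x r) f :=
    (isConvexFun_iff_convexOn (convex_ball x r)).1 (fun a b hab => hf a b (hab.trans hb))
  exact ((hc.continuousOn Metric.isOpen_ball).continuousAt
    (Metric.isOpen_ball.mem_nhds (Metric.mem_ball_self hr))).continuousWithinAt

/-- The image of a compact subset of `Ω` under the normal mapping is closed. -/
theorem isClosed_normalImage {Ω : Set E} {f : E → ℝ} (hf : ContinuousOn f Ω) {K : Set E}
    (hK : IsCompact K) (hKΩ : K ⊆ Ω) : IsClosed (normalImage Ω f K) := by
  refine IsSeqClosed.isClosed ?_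
  intro p q hp hpq
  choose x hx hxp using fun n => mem_normalImage.1 (hp n)
  obtain ⟨a, ha, φ, hφ, hlim⟩ := hK.tendsto_subseq (fun n => (hx n).1)
  refine mem_normalImage.2 ⟨a, ⟨ha, hKΩ ha⟩, ?_⟩
  intro z hz
  have hfa : Tendsto (fun n => f (x (φ n))) atTop (𝓝 (f a)) := by
    have h1 : Tendsto (fun n => x (φ n)) atTop (𝓝[Ω] a) :=
      tendsto_nhdsWithin_iff.2 ⟨hlim, Eventually.of_forall fun n => (hx _).2⟩
    exact (hf a (hKΩ ha)).tendsto.comp h1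
  have hpa : Tendsto (fun n => p (φ n)) atTop (𝓝 q) := hpq.comp hφ.tendsto_atTop
  have hin : Tendsto (fun n => ⟪p (φ n), z - x (φ n)⟫) atTop (𝓝 ⟪q, z - a⟫) :=
    hpa.inner (tendsto_const_nhds.sub hlim)
  exact le_of_tendsto (hfa.add hin) (Eventually.of_forall fun n => hxp (φ n) z hz)

variable [FiniteDimensional ℝ E] [MeasurableSpace E] [BorelSpace E]

theorem measurableSet_normalImage {Ω : Set E} (hΩ : IsOpen Ω) {f : E → ℝ}
    (hf : ContinuousOn f Ω) {F : Set E} (hF : IsClosed F) :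
    MeasurableSet (normalImage Ω f F) := by
  obtain ⟨C, hC, hCc, hCU, -⟩ := hΩ.exists_iUnion_isClosed
  have h : normalImage Ω f F =
      ⋃ n : ℕ, ⋃ k : ℕ, normalImage Ω f (C n ∩ F ∩ Metric.closedBall 0 (k : ℝ)) := by
    ext p
    simp only [mem_iUnion, mem_normalImage]
    constructor
    · rintro ⟨x, ⟨hxF, hxΩ⟩, hp⟩
      rw [← hCU] at hxΩ
      obtain ⟨n, hn⟩ := mem_iUnion.1 hxΩ
      obtain ⟨k, hk⟩ := exists_nat_ge ‖x‖
      exact ⟨n, k, x, ⟨⟨⟨hn, hxF⟩, by simpa using hk⟩, hCc n hn⟩, hp⟩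
    · rintro ⟨n, k, x, ⟨⟨⟨-, hxF⟩, -⟩, hxΩ⟩, hp⟩
      exact ⟨x, ⟨hxF, hxΩ⟩, hp⟩
  rw [h]
  refine MeasurableSet.iUnion fun n => MeasurableSet.iUnion fun k => ?_
  refine (isClosed_normalImage hf ?_ ?_).measurableSet
  · exact (isCompact_closedBall _ _).inter_left ((hC n).inter hF)
  · exact fun x hx => hCc n hx.1.1

/-- The slopes that support `f` at two different points of a bounded set form a null set. -/
theorem volume_overlap_bounded (A : Set E) (k : ℝ≥0) (hA : ∀ x ∈ A, ‖x‖ ≤ k) (f : E → ℝ) :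
    volume {p : E | ∃ x ∈ A, ∃ y ∈ A, x ≠ y ∧ p ∈ normalMap A f x ∧ p ∈ normalMap A f y} = 0 := by
  rcases eq_empty_or_nonempty {p : E | ∃ x ∈ A, ∃ y ∈ A, x ≠ y ∧ p ∈ normalMap A f x ∧
    p ∈ normalMap A f y} with h0 | ⟨p₀, x₀, hx₀, -, -, -, hp₀, -⟩
  · rw [h0]; simp
  set g : E → ℝ := fun q => ⨆ z : A, (⟪q, (z : E)⟫ - f z) with hg
  have hbdd : ∀ q, BddAbove (range fun z : A => (⟪q, (z : E)⟫ - f z)) := by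
    intro q
    refine ⟨‖q - p₀‖ * k + ⟪p₀, x₀⟫ - f x₀, ?_⟩
    rintro _ ⟨⟨z, hz⟩, rfl⟩
    have h1 := hp₀ z hz
    have h2 : ⟪q - p₀, z⟫ ≤ ‖q - p₀‖ * k :=
      (real_inner_le_norm _ _).trans (mul_le_mul_of_nonneg_left (hA z hz) (norm_nonneg _))
    rw [inner_sub_right] at h1
    rw [inner_sub_left] at h2
    dsimp only
    linarith
  have hne : Nonempty A := ⟨⟨x₀, hx₀⟩⟩
  have hlip : LipschitzWith k g := by
    refine LipschitzWith.of_le_add_mul k fun q q' => ?_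
    refine ciSup_le fun z => ?_
    have h1 : ⟪q', (z : E)⟫ - f z ≤ g q' := le_ciSup (hbdd q') z
    have h2 : ⟪q - q', (z : E)⟫ ≤ k * dist q q' := by
      rw [dist_eq_norm, mul_comm]
      exact (real_inner_le_norm _ _).trans
        (mul_le_mul_of_nonneg_left (hA z z.2) (norm_nonneg _))
    rw [inner_sub_left] at h2
    linarith
  have hae := hlip.ae_differentiableAt (μ := (volume : Measure E))
  refine measure_mono_null ?_ (ae_iff.1 hae)
  rintro p ⟨x, hx, y, hy, hxy, hpx, hpy⟩ hd
  have key : ∀ w ∈ A, p ∈ normalMap A f w → fderiv ℝ g p = innerSL ℝ w := by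
    intro w hw hpw
    have hval : g p = ⟪p, w⟫ - f w := by
      refine le_antisymm (ciSup_le fun z => ?_) (le_ciSup (hbdd p) ⟨w, hw⟩)
      have := hpw z z.2
      rw [inner_sub_right] at this
      linarith
    have hmin : IsLocalMin (fun q => g q - innerSL ℝ w q) p := by
      refine Eventually.of_forall fun q => ?_
      have h1 : ⟪q, w⟫ - f w ≤ g q := le_ciSup (hbdd q) ⟨w, hw⟩
      simp only [innerSL_apply_apply]
      rw [hval, real_inner_comm p w, real_inner_comm q w]
      linarith
    have := hmin.hasFDerivAt_eq_zero (hd.hasFDerivAt.sub (innerSL ℝ w).hasFDerivAt)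
    exact sub_eq_zero.1 this
  have h := (key x hx hpx).symm.trans (key y hy hpy)
  apply hxy
  refine ext_inner_right ℝ fun v => ?_
  simpa using DFunLike.congr_fun h v

/-- The slopes that support `f` at two different points of `Ω` form a null set. -/
theorem volume_overlap (Ω : Set E) (f : E → ℝ) :
    volume {p : E | ∃ x ∈ Ω, ∃ y ∈ Ω, x ≠ y ∧ p ∈ normalMap Ω f x ∧ p ∈ normalMap Ω f y} = 0 := by
  refine measure_mono_null ?_ (measure_iUnion_null fun k : ℕ =>
    volume_overlap_bounded (Ω ∩ Metric.closedBall 0 (k : ℝ)) (k : ℝ≥0) (fun x hx => by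
      simpa using hx.2) f)
  rintro p ⟨x, hx, y, hy, hxy, hpx, hpy⟩
  obtain ⟨k, hk⟩ := exists_nat_ge (max ‖x‖ ‖y‖)
  refine mem_iUnion.2 ⟨k, x, ⟨hx, ?_⟩, y, ⟨hy, ?_⟩, hxy, fun z hz => hpx z hz.1,
    fun z hz => hpy z hz.1⟩
  · simpa using (le_max_left _ _).trans hk
  · simpa using (le_max_right _ _).trans hk

/-- The set function `S ↦ ∫_{∂f(S)} π dy` (`dy` is Lebesgue measure), on all sets. -/
noncomputable def maOuter (π : E → ℝ) (Ω : Set E) (f : E → ℝ) : OuterMeasure E where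
  measureOf S := (volume.withDensity fun y => ENNReal.ofReal (π y)) (normalImage Ω f S)
  empty := by simp [normalImage]
  mono {S T} h := measure_mono (biUnion_subset_biUnion_left (inter_subset_inter_left Ω h))
  iUnion_nat S _ := by
    refine (measure_mono ?_).trans (measure_iUnion_le _)
    intro p hp
    obtain ⟨x, ⟨hxS, hxΩ⟩, hxp⟩ := mem_normalImage.1 hp
    obtain ⟨n, hn⟩ := mem_iUnion.1 hxS
    exact mem_iUnion.2 ⟨n, mem_normalImage.2 ⟨x, ⟨hn, hxΩ⟩, hxp⟩⟩

/-- All Borel sets are measurable for this set function. -/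
theorem borel_le_caratheodory (π : E → ℝ) {Ω : Set E} (hΩ : IsOpen Ω) {f : E → ℝ}
    (hf : ContinuousOn f Ω) : ‹MeasurableSpace E› ≤ (maOuter π Ω f).caratheodory := by
  refine ((BorelSpace.measurable_eq (α := E)).trans borel_eq_generateFrom_isClosed).le.trans ?_
  refine MeasurableSpace.generateFrom_le fun F hF => ?_
  refine (OuterMeasure.isCaratheodory_iff_le _).2 fun T => ?_
  set ν : Measure E := volume.withDensity fun y => ENNReal.ofReal (π y) with hν
  set N : Set E :=
    {p : E | ∃ x ∈ Ω, ∃ y ∈ Ω, x ≠ y ∧ p ∈ normalMap Ω f x ∧ p ∈ normalMap Ω f y}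
  have hN : ν N = 0 := withDensity_absolutelyContinuous _ _ (volume_overlap Ω f)
  change ν (normalImage Ω f (T ∩ F)) + ν (normalImage Ω f (T \ F)) ≤ ν (normalImage Ω f T)
  have h1 : normalImage Ω f (T ∩ F) ⊆ normalImage Ω f T ∩ normalImage Ω f F := by
    intro p hp
    obtain ⟨x, ⟨hx, hxΩ⟩, hxp⟩ := mem_normalImage.1 hp
    exact ⟨mem_normalImage.2 ⟨x, ⟨hx.1, hxΩ⟩, hxp⟩, mem_normalImage.2 ⟨x, ⟨hx.2, hxΩ⟩, hxp⟩⟩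
  have h2 : normalImage Ω f (T \ F) ⊆ (normalImage Ω f T \ normalImage Ω f F) ∪ N := by
    intro p hp
    obtain ⟨x, ⟨hx, hxΩ⟩, hxp⟩ := mem_normalImage.1 hp
    by_cases hpF : p ∈ normalImage Ω f F
    · obtain ⟨y, ⟨hy, hyΩ⟩, hyp⟩ := mem_normalImage.1 hpF
      exact Or.inr ⟨x, hxΩ, y, hyΩ, fun h => hx.2 (h ▸ hy), hxp, hyp⟩
    · exact Or.inl ⟨mem_normalImage.2 ⟨x, ⟨hx.1, hxΩ⟩, hxp⟩, hpF⟩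
  have h3 : ν (normalImage Ω f (T \ F)) ≤ ν (normalImage Ω f T \ normalImage Ω f F) := by
    refine (measure_mono h2).trans ((measure_union_le _ _).trans ?_)
    rw [hN, add_zero]
  calc _ ≤ ν (normalImage Ω f T ∩ normalImage Ω f F)
          + ν (normalImage Ω f T \ normalImage Ω f F) := add_le_add (measure_mono h1) h3
    _ = ν (normalImage Ω f T) :=
        measure_inter_add_sdiff _ (measurableSet_normalImage hΩ hf hF)

/-- The real Monge–Ampère measure with weight `π ≥ 0` of a convex function `f` on an open set `Ω`,
as a Borel measure (carried by `Ω`); see `mongeAmpere_apply`. -/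
noncomputable def mongeAmpere (π : E → ℝ) {Ω : Set E} (hΩ : IsOpen Ω) {f : E → ℝ}
    (hf : IsConvexFun Ω f) : Measure E :=
  (maOuter π Ω f).toMeasure (borel_le_caratheodory π hΩ (hf.continuousOn hΩ))

/-- The defining property: the measure of a Borel set `S` is `∫_{∂f(S)} π dy`. -/
theorem mongeAmpere_apply (π : E → ℝ) {Ω : Set E} (hΩ : IsOpen Ω) {f : E → ℝ}
    (hf : IsConvexFun Ω f) {S : Set E} (hS : MeasurableSet S) :
    mongeAmpere π hΩ hf S = ∫⁻ y in normalImage Ω f S, ENNReal.ofReal (π y) := by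
  rw [mongeAmpere, toMeasure_apply _ _ hS]
  exact withDensity_apply' _ _

end Convex

end WeightedMA

namespace WeightedMA

section ComparisonPrinciple

variable {E : Type*} [NormedAddCommGroup E] [InnerProductSpace ℝ E]

/-! The inclusion `∂φ(Ω) ⊆ ∂ψ(Ω)` already holds as sets (`normalImage_subset_of_le`), so the
inequality follows for any weight by enlarging the domain of integration. Let `p` support `φ` at
`x`, and let `m` be the minimum of `φ - ⟪p, ·⟫`, attained at `x`. Lower the function to `ψ - ⟪p,
·⟫`: it must still attain its minimum in `Ω`. Any value below `m` lies a definite gap under `φ - ⟪p,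
·⟫`, and this gap closes at the boundary, so sublevel sets below `m` are compact in `Ω`
(`isClosed_sublevel_of_tendsto_frontier`). Convexity of `ψ` enters the inclusion only through
continuity. -/

/-- A slope supports `f` at `x` if and only if `x` minimizes `f - ⟪p, ·⟫` on `Ω`. -/
theorem mem_normalMap_iff_isMinOn {Ω : Set E} {f : E → ℝ} {x p : E} :
    p ∈ normalMap Ω f x ↔ IsMinOn (fun z => f z - ⟪p, z⟫) Ω x := by
  simp only [normalMap, mem_ofPred_eq, isMinOn_iff, inner_sub_right]
  refine forall₂_congr fun z _ => ?_
  constructor <;> intro h <;> linarith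

/-- If `φ` stays above `m + ⟪p, ·⟫` on `Ω` and `φ - ψ` vanishes on the boundary, then the sublevel
sets of `ψ - ⟪p, ·⟫` below the level `m` are closed. -/
theorem isClosed_sublevel_of_tendsto_frontier {Ω : Set E} (hΩ : IsOpen Ω)
    {φ ψ : E → ℝ} (hψ : ContinuousOn ψ Ω)
    (hbd : ∀ z ∈ frontier Ω, Tendsto (fun x => φ x - ψ x) (𝓝[Ω] z) (𝓝 0))
    {p : E} {m c : ℝ} (hφ : ∀ z ∈ Ω, m ≤ φ z - ⟪p, z⟫) (hc : c < m) :
    IsClosed {z ∈ Ω | ψ z - ⟪p, z⟫ ≤ c} := by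
  refine isClosed_of_closure_subset fun z hz => ?_
  have hsub : {z ∈ Ω | ψ z - ⟪p, z⟫ ≤ c} ⊆ Ω := sep_subset _ _
  have : (𝓝[{z ∈ Ω | ψ z - ⟪p, z⟫ ≤ c}] z).NeBot := mem_closure_iff_nhdsWithin_neBot.1 hz
  by_cases hzΩ : z ∈ Ω
  · refine ⟨hzΩ, ?_⟩
    have hcont : ContinuousOn (fun z => ψ z - ⟪p, z⟫) Ω :=
      hψ.sub (continuous_const.inner continuous_id).continuousOn
    exact le_of_tendsto ((hcont z hzΩ).mono_left (nhdsWithin_mono z hsub))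
      (eventually_mem_nhdsWithin.mono fun w hw => hw.2)
  · have hfr : z ∈ frontier Ω := by
      rw [hΩ.frontier_eq]
      exact ⟨closure_mono hsub hz, hzΩ⟩
    -- On the sublevel set `φ - ψ ≥ m - c > 0`, which is incompatible with the limit `0` at a
    -- boundary point.
    have h := ge_of_tendsto (b := m - c) ((hbd z hfr).mono_left (nhdsWithin_mono z hsub))
      (eventually_mem_nhdsWithin.mono fun w hw => by linarith [hφ w hw.1, hw.2])
    linarith

/-- On a bounded open set, if `ψ ≤ φ` with equality on the boundary, then every slope that supports
`φ` somewhere also supports `ψ` somewhere. -/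
theorem normalImage_subset_of_le [FiniteDimensional ℝ E] {Ω : Set E} (hΩ : IsOpen Ω)
    (hΩbdd : Bornology.IsBounded Ω) {φ ψ : E → ℝ} (hψ : ContinuousOn ψ Ω)
    (hle : ∀ x ∈ Ω, ψ x ≤ φ x)
    (hbd : ∀ z ∈ frontier Ω, Tendsto (fun x => φ x - ψ x) (𝓝[Ω] z) (𝓝 0)) :
    normalImage Ω φ Ω ⊆ normalImage Ω ψ Ω := by
  intro p hp
  obtain ⟨x, ⟨hx, -⟩, hpx⟩ := mem_normalImage.1 hp
  have hφ : ∀ z ∈ Ω, φ x - ⟪p, x⟫ ≤ φ z - ⟪p, z⟫ :=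
    isMinOn_iff.1 (mem_normalMap_iff_isMinOn.1 hpx)
  suffices h : ∃ w ∈ Ω, ∀ z ∈ Ω, ψ w - ⟪p, w⟫ ≤ ψ z - ⟪p, z⟫ by
    obtain ⟨w, hw, hmin⟩ := h
    exact mem_normalImage.2 ⟨w, ⟨hw, hw⟩, mem_normalMap_iff_isMinOn.2 (isMinOn_iff.2 hmin)⟩
  by_cases h : ∀ z ∈ Ω, φ x - ⟪p, x⟫ ≤ ψ z - ⟪p, z⟫
  -- Here `x` itself is a minimizer, since `ψ x ≤ φ x` puts its value at or below the lower bound.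
  · exact ⟨x, hx, fun z hz => (sub_le_sub_right (hle x hx) _).trans (h z hz)⟩
  · push Not at h
    obtain ⟨y, hy, hlt⟩ := h
    -- The level is the value at `y`: strictly below the minimum of `φ - ⟪p, ·⟫`, as closedness
    -- requires, and attained, so the set is nonempty.
    have hK : IsCompact {z ∈ Ω | ψ z - ⟪p, z⟫ ≤ ψ y - ⟪p, y⟫} :=
      Metric.isCompact_of_isClosed_isBounded
        (isClosed_sublevel_of_tendsto_frontier hΩ hψ hbd hφ hlt) (hΩbdd.subset (sep_subset _ _))
    have hcont : ContinuousOn (fun z => ψ z - ⟪p, z⟫) Ω :=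
      hψ.sub (continuous_const.inner continuous_id).continuousOn
    obtain ⟨w, hw, hmin⟩ :=
      hK.exists_isMinOn ⟨y, hy, le_rfl⟩ (hcont.mono (sep_subset _ _))
    refine ⟨w, hw.1, fun z hz => ?_⟩
    by_cases hzy : ψ z - ⟪p, z⟫ ≤ ψ y - ⟪p, y⟫
    · exact isMinOn_iff.1 hmin z ⟨hz, hzy⟩
    -- Off the sublevel set the values exceed the one at `y`, so the minimum over the compact set is
    -- global on `Ω`.
    · exact hw.2.trans (not_le.1 hzy).le

end ComparisonPrinciple

end WeightedMA

theorem mainTheorem8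
    {𝔞 : Type*} [NormedAddCommGroup 𝔞] [InnerProductSpace ℝ 𝔞] [FiniteDimensional ℝ 𝔞]
    [MeasurableSpace 𝔞] [BorelSpace 𝔞]
    {ι : Type*} [Fintype ι]
    (P : RootPairing ι ℝ (Module.Dual ℝ 𝔞) 𝔞) [P.IsCrystallographic] [P.IsReduced]
    (hP : P.toLinearMap = LinearMap.id)
    (hinv : ∀ w ∈ WeightedMA.weylGroup P, ∀ x y : 𝔞, ⟪w x, w y⟫ = ⟪x, y⟫)
    (b : P.Base)
    (Ω : Set 𝔞) (hΩ : IsOpen Ω) (hΩconn : IsConnected Ω) (hΩbdd : Bornology.IsBounded Ω)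
    (hΩW : WeightedMA.IsWeylInvariant P Ω)
    (φ ψ : 𝔞 → ℝ) (hφ : WeightedMA.IsConvexFun Ω φ) (hψ : WeightedMA.IsConvexFun Ω ψ)
    (hle : ∀ x ∈ Ω, ψ x ≤ φ x)
    (hbd : ∀ z ∈ frontier Ω, Tendsto (fun x => φ x - ψ x) (𝓝[Ω] z) (𝓝 0)) :
    WeightedMA.mongeAmpere (WeightedMA.weight b) hΩ hφ Ω ≤
      WeightedMA.mongeAmpere (WeightedMA.weight b) hΩ hψ Ω := by
  rw [WeightedMA.mongeAmpere_apply _ hΩ hφ hΩ.measurableSet,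
    WeightedMA.mongeAmpere_apply _ hΩ hψ hΩ.measurableSet]
  exact lintegral_mono_set
    (WeightedMA.normalImage_subset_of_le hΩ hΩbdd (hψ.continuousOn hΩ) hle hbd)
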